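/- **Setting (hyperbolic metrics).** Let $\Sigma=\mathbb H^2/\Gamma$ be a closed oriented hyperbolic surface (so of genus $g\ge 2$) with a pants decomposition by disjoint simple closed geodesics, and let $\alpha$ be one of these geodesics, oriented, with a lift $\tilde\alpha\subset\mathbb H^2$. A *seam* of a pair of pants is the embedded geodesic arc orthogonal to two different boundary components at its ends. Choose lifts, starting on $\tilde\alpha$, of a seam of the pair of pants to the right of $\alpha$ and of a seam of the pair of pants to the left of $\alpha$. With respect to this marking, the *Fenchel–Nielsen coordinates* at $\alpha$ are $(2\ell,2\tau)\in\mathbb R^+\times\mathbb R$, where $2\ell$ is the length of $\alpha$ and $2\tau$ is the signed distance along $\tilde\alpha$ between the feet of the two seams, positive if to an observer who faces $\tilde\alpha$ the far side is displaced to the left. The *standard collar* of $\alpha$ is the annulus that is covered by the points at distance at most $\kappa(\ell)=\sinh^{-1}(1/\sinh \ell)$ from $\tilde\alpha$; its basepoints $r$ (right) and $s$ (left) are the points where the two seams meet its boundary. Let $g\in\Gamma$ be the translation by $2\ell$ along $\tilde\alpha$ in the direction of $\alpha$, let $u$ be the point where the geodesic $\beta$ from $r$ to $s$ meets $\tilde\alpha$,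 and $v$ the point where the geodesic $\gamma$ from $g^{-1}r$ to $s$ meets $\tilde\alpha$. The *triangle lengths* at $\alpha$ are the side lengths $a=d(v,u)$, $b=d(u,s)$, $c=d(v,s)$ of the geodesic reference triangle $v,u,s$. **Setting (measured foliations).** In the annulus $\mathbb A=(\mathbb R/2\mathbb Z)\times[-1,1]$ around a pants curve, with basepoints $(1,\pm1)$, a standard measured foliation is linear, that is, covered by $|df|$ for a linear map $f:\mathbb R^2\to\mathbb R$. Its *Dehn–Thurston coordinates* at this curve are $(2\ell,2\tau)\in\mathbb R_{\ge0}\times\mathbb R$, where $2\ell$ is the transverse measure of the core circle, $|2\tau|$ is the transverse measure of the arc $1\times[-1,1]$, and, if $\ell>0$, the sign of $\tau$ is that of the slope of the leaves (if $\ell=0$ both signs are allowed). Its *triangle lengths* $(a,b,c)$ are the integrals of $|df|$ along the sides $[0,1]\times0$, $1\times[0,1]$, $\{(t,t):0\le t\le1\}$ of the reference triangle. In both cases the *collar parameters* are $(x,y)=(4a-2b-2c,\,2b-2c)$. **Proposition.** (i) If $(2\ell,2\tau)\in\mathbb R^+\times\mathbb R$ are Fenchel–Nielsen coordinates, then the triangle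 lengths exist and are uniquely determined; they are $$a=\ell,\qquad b=\cosh^{-1}(\cosh\tau\coth\ell),\qquad c=\cosh^{-1}(\cosh(\ell-\tau)\coth\ell),$$ and the collar parameters are $$x=4\ell-2\cosh^{-1}(\cosh\tau\coth\ell)-2\cosh^{-1}(\cosh(\ell-\tau)\coth\ell),$$ $$y=2\cosh^{-1}(\cosh\tau\coth\ell)-2\cosh^{-1}(\cosh(\ell-\tau)\coth\ell).$$ (ii) If $(2\ell,2\tau)\in\mathbb R_{\ge0}\times\mathbb R$ are Dehn–Thurston coordinates, then the triangle lengths are $$a=\ell,\qquad b=|\tau|,\qquad c=|\ell-\tau|,$$ and the collar parameters are $$x=4\ell-2|\tau|-2|\ell-\tau|,\qquad y=2|\tau|-2|\ell-\tau|.$$ -/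

import Mathlib

open scoped MatrixGroups UpperHalfPlane Pointwise

noncomputable section

namespace CollarParameters

/-! ### Triangle lengths and collar parameters -/

/-- The linear map `π(a, b, c) = (4a - 2b - 2c, 2b - 2c)` that sends triangle lengths to collar
parameters. -/
def collarMap (v : ℝ × ℝ × ℝ) : ℝ × ℝ :=
  (4 * v.1 - 2 * v.2.1 - 2 * v.2.2, 2 * v.2.1 - 2 * v.2.2)

/-- The hyperbolic cotangent. -/
def coth (x : ℝ) : ℝ := Real.cosh x / Real.sinh x

/-! ### Geodesics of the hyperbolic plane

The hyperbolic plane is the upper half-plane `ℍ` with its hyperbolic metric; `SL(2, ℝ)` acts on it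
by all the orientation preserving isometries. -/

/-- The point `i e ^ t` of the imaginary axis; `t` is the arc length parameter, growing upwards. -/
def axisPoint (t : ℝ) : ℍ := UpperHalfPlane.mk ⟨0, Real.exp t⟩ (Real.exp_pos t)

/-- The oriented unit speed geodesic that is the image under `k` of the imaginary axis. Every
oriented unit speed geodesic line of `ℍ` is of this form. -/
def geodesic (k : SL(2, ℝ)) (t : ℝ) : ℍ := k • axisPoint t

/-- The geodesic line traced by `geodesic k`. -/
def line (k : SL(2, ℝ)) : Set ℍ := Set.range (geodesic k)

/-- The open half-plane to the left of the oriented geodesic `geodesic k`. -/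
def leftSide (k : SL(2, ℝ)) : Set ℍ := {z | (k⁻¹ • z).re < 0}

/-- The open half-plane to the right of the oriented geodesic `geodesic k`. -/
def rightSide (k : SL(2, ℝ)) : Set ℍ := {z | 0 < (k⁻¹ • z).re}

/-- The geodesic segment from `p` to `q`. -/
def seg (p q : ℍ) : Set ℍ := {w | dist p w + dist w q = dist p q}

/-! ### Closed hyperbolic surfaces and pants decompositions -/

/-- `Γ` acts on `ℍ` as the group of deck transformations of a closed oriented hyperbolic surface
`ℍ / Γ` (necessarily connected and of genus at least two). Elements that act trivially on `ℍ`
are allowed, so that `Γ` may be the preimage of a subgroup of `PSL(2, ℝ)`. -/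
structure IsClosedSurfaceGroup (Γ : Subgroup SL(2, ℝ)) : Prop where
  properlyDiscontinuous : ProperlyDiscontinuousSMul Γ ℍ
  free : ∀ g ∈ Γ, ∀ z : ℍ, g • z = z → ∀ w : ℍ, g • w = w
  cocompact : CompactSpace (Quotient (MulAction.orbitRel Γ ℍ))

/-- The covering projection `ℍ → ℍ / Γ`. -/
def proj (Γ : Subgroup SL(2, ℝ)) : ℍ → Quotient (MulAction.orbitRel Γ ℍ) := Quotient.mk _

/-- The family `𝓛` of geodesic lines is the full preimage in `ℍ` of a geodesic pants decomposition
of `ℍ / Γ`: a finite set of pairwise disjoint simple closed geodesics such that each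
component of the complement of their union is a three-holed sphere. -/
structure IsPantsDecomposition (Γ : Subgroup SL(2, ℝ)) (𝓛 : Set (Set ℍ)) : Prop where
  /-- The members are geodesic lines. -/
  isLine : ∀ A ∈ 𝓛, ∃ k : SL(2, ℝ), A = line k
  /-- Distinct members are disjoint: the curves are simple and pairwise disjoint. -/
  disjoint : ∀ A ∈ 𝓛, ∀ B ∈ 𝓛, A ≠ B → Disjoint A B
  /-- The family is the set of all lifts of finitely many curves. -/
  lifts : ∃ F : Set (Set ℍ), F.Finite ∧ 𝓛 = {B | ∃ A ∈ F, ∃ g ∈ Γ, B = g • A}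
  /-- The image of each member in the surface is a closed geodesic. -/
  closed : ∀ A ∈ 𝓛, ∃ g ∈ Γ, g • A = A ∧ ∃ z ∈ A, g • z ≠ z
  /-- Each complementary component is homeomorphic to the plane with two points removed. -/
  pants : ∀ x ∈ (proj Γ '' (⋃₀ 𝓛))ᶜ,
    Nonempty (connectedComponentIn (proj Γ '' (⋃₀ 𝓛))ᶜ x ≃ₜ {z : ℂ // z ≠ 0 ∧ z ≠ 1})

/-- `U` is a component of the complement in `ℍ` of the lines of `𝓛`. It is a lift of (the interior
of) a pair of pants, whose fundamental group acts on `U` as the stabilizer of `U` in `Γ`; the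
boundary curves of the pants are the orbits, under this stabilizer, of the lines of `𝓛` in the
closure of `U`. -/
def IsPantsLift (𝓛 : Set (Set ℍ)) (U : Set ℍ) : Prop :=
  ∃ z ∈ (⋃₀ 𝓛)ᶜ, U = connectedComponentIn (⋃₀ 𝓛)ᶜ z

/-- The segment from `p` to `q` is a lift, to the lift `U` of a pair of pants, of the seam that
connects the boundary component covered by `A` to another boundary component, covered by `L`:
the embedded geodesic arc in the pants that meets both of them orthogonally. -/
structure IsSeam (Γ : Subgroup SL(2, ℝ)) (𝓛 : Set (Set ℍ)) (U A L : Set ℍ) (p q : ℍ) : Prop where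
  isPantsLift : IsPantsLift 𝓛 U
  mem_left : A ∈ 𝓛
  mem_right : L ∈ 𝓛
  boundary_left : A ⊆ closure U
  boundary_right : L ⊆ closure U
  /-- The two boundary components of the pants are different. -/
  distinct : ∀ g ∈ Γ, g • U = U → g • A ≠ L
  start_mem : p ∈ A
  end_mem : q ∈ L
  /-- The segment is the common perpendicular, that is, the shortest segment from `A` to `L`. -/
  perpendicular : ∀ x ∈ A, ∀ y ∈ L, dist p q ≤ dist x y
  /-- The segment projects injectively to the pants. -/
  embedded : ∀ g ∈ Γ, g • U = U → (∃ w : ℍ, g • w ≠ w) → Disjoint (g • seg p q) (seg p q)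

/-- An oriented lift `geodesic frame` of a curve of the pants decomposition, together with lifts of
a seam of the pair of pants on its left and of a seam of the pair of pants on its right, both of
which start on the given lift. These choices are the marking with respect to which the twist and
the triangle are defined. -/
structure MarkedCurve (Γ : Subgroup SL(2, ℝ)) (𝓛 : Set (Set ℍ)) where
  frame : SL(2, ℝ)
  leftPants : Set ℍ
  leftLine : Set ℍ
  leftFoot : ℍ
  leftEnd : ℍ
  leftPants_subset : leftPants ⊆ leftSide frame
  leftSeam : IsSeam Γ 𝓛 leftPants (line frame) leftLine leftFoot leftEnd
  rightPants : Set ℍ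
  rightLine : Set ℍ
  rightFoot : ℍ
  rightEnd : ℍ
  rightPants_subset : rightPants ⊆ rightSide frame
  rightSeam : IsSeam Γ 𝓛 rightPants (line frame) rightLine rightFoot rightEnd

/-! ### Fenchel-Nielsen coordinates -/

/-- The element `g` of `Γ` is the translation by `len > 0` in the positive direction along
`geodesic k` and generates (up to elements that act trivially) the stabilizer of that line. So
`len` is the length of the closed geodesic covered by `line k`. -/
structure IsCoreTranslation (Γ : Subgroup SL(2, ℝ)) (k g : SL(2, ℝ)) (len : ℝ) : Prop where
  mem : g ∈ Γ
  pos : 0 < len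
  translates : ∀ t : ℝ, g • geodesic k t = geodesic k (t + len)
  generates : ∀ h ∈ Γ, h • line k = line k →
    ∃ n : ℤ, ∀ t : ℝ, h • geodesic k t = geodesic k (t + n * len)

/-- `(len, twist)` are the Fenchel-Nielsen coordinates at the marked curve: `len` is the length
of the closed geodesic, and `twist` is the signed distance along it between the feet of the two
seams. The sign is positive if, to an observer on either side who faces the curve, the far
side is displaced to the left. -/
def IsFenchelNielsen {Γ : Subgroup SL(2, ℝ)} {𝓛 : Set (Set ℍ)} (M : MarkedCurve Γ 𝓛)
    (len twist : ℝ) : Prop :=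
  (∃ g, IsCoreTranslation Γ M.frame g len) ∧
  ∃ t : ℝ, M.rightFoot = geodesic M.frame t ∧ M.leftFoot = geodesic M.frame (t - twist)

/-! ### The geodesic reference triangle of a standard collar -/

/-- The depth `κ(a) = arsinh (1 / sinh a)` of a standard collar whose core has length `2a`. -/
def collarDepth (a : ℝ) : ℝ := Real.arsinh (1 / Real.sinh a)

/-- `(a, b, c)` are the side lengths of the geodesic reference triangle in the standard collar of the
marked curve. All is lifted to `ℍ`, where the universal cover of the collar is the convex set of
points at distance at most `collarDepth (len / 2)` from the axis, on which the core translation `g`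
acts as the deck transformation. The basepoints are the points `r` (right) and `s` (left) in which
the seams meet the boundary of the collar. The arc `β` runs from `r` to `s` and meets the core
at `u`; the arc `γ` runs from `g⁻¹ • r` to `s`, that is, once around the collar in the
positive direction and then along `β`, and it meets the core at `v`. The vertices
of the triangle are `v`, `u`, `s`. -/
def IsTriangleLengths {Γ : Subgroup SL(2, ℝ)} {𝓛 : Set (Set ℍ)} (M : MarkedCurve Γ 𝓛)
    (a b c : ℝ) : Prop :=
  ∃ (g : SL(2, ℝ)) (len : ℝ) (r s u v : ℍ),
    IsCoreTranslation Γ M.frame g len ∧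
    r ∈ seg M.rightFoot M.rightEnd ∧
    Metric.infDist r (line M.frame) = collarDepth (len / 2) ∧
    s ∈ seg M.leftFoot M.leftEnd ∧
    Metric.infDist s (line M.frame) = collarDepth (len / 2) ∧
    u ∈ line M.frame ∧ u ∈ seg r s ∧
    v ∈ line M.frame ∧ v ∈ seg (g⁻¹ • r) s ∧
    a = dist v u ∧ b = dist u s ∧ c = dist v s

/-- `xy` is the pair of collar parameters of the hyperbolic metric at the marked curve. -/
def IsCollarParameters {Γ : Subgroup SL(2, ℝ)} {𝓛 : Set (Set ℍ)} (M : MarkedCurve Γ 𝓛)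
    (xy : ℝ × ℝ) : Prop :=
  ∃ a b c : ℝ, IsTriangleLengths M a b c ∧ xy = collarMap (a, b, c)

/-! ### Linear measured foliations on the standard annulus

The standard annulus is `(ℝ / 2ℤ) × [-1, 1]`, with universal cover `ℝ × [-1, 1]` and basepoints the
images of `(1, -1)` and `(1, 1)`. A linear measured foliation is covered by `|df|` for a linear map
`f : ℝ × ℝ → ℝ`: the leaves are the level lines of `f`, the transverse measure is `∫ |df|`. Paths in
the annulus are given by their lifts. -/

/-- The transverse measure `∫ |df|` of the path `c` on the parameter interval `[0, 1]`. -/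
def transverseMeasure (f : ℝ × ℝ →ₗ[ℝ] ℝ) (c : ℝ → ℝ × ℝ) : ℝ :=
  ∫ t in (0 : ℝ)..1, |deriv (fun s => f (c s)) t|

/-- The straight path from `P` to `Q`. -/
def straight (P Q : ℝ × ℝ) (t : ℝ) : ℝ × ℝ := AffineMap.lineMap P Q t

/-- The lengths of the sides `[0, 1] × 0`, `1 × [0, 1]` and `{(t, t)}` of the reference triangle. -/
def foliationTriangle (f : ℝ × ℝ →ₗ[ℝ] ℝ) : ℝ × ℝ × ℝ :=
  (transverseMeasure f (straight (0, 0) (1, 0)),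
    transverseMeasure f (straight (1, 0) (1, 1)),
    transverseMeasure f (straight (0, 0) (1, 1)))

/-- `(m, t)` are the Dehn-Thurston coordinates of the linear foliation `|df|`: the number `m` is the
transverse measure of the core circle; `|t|` is the transverse measure of the arc that crosses
the annulus from basepoint to basepoint; and if `m > 0`, so that the leaves cross the
annulus, the sign of `t` is the direction in which they turn: `t ≥ 0` if the leaves have
nonnegative slope (drift in the positive direction on the way up) and `t ≤ 0` if they have
nonpositive slope. If `m = 0` the sign of `t` carries no information: `(0, t)` and `(0, -t)` are
coordinates of the same foliation. -/
def IsDehnThurston (f : ℝ × ℝ →ₗ[ℝ] ℝ) (m t : ℝ) : Prop :=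
  m = transverseMeasure f (straight (-1, 0) (1, 0)) ∧
  |t| = transverseMeasure f (straight (1, -1) (1, 1)) ∧
  (0 < m → ∀ w : ℝ × ℝ, f w = 0 → 0 ≤ t * (w.1 * w.2))

end CollarParameters

end

namespace CollarParameters

noncomputable section

/-! ### Fermi coordinates about the imaginary axis -/

/-! Use Fermi coordinates `(t, σ)` about the lift of `α`: position along the axis and signed
distance from it. The seams are perpendicular to the axis, so the basepoints are `r = (t, κ)` and `s
= (t - 2τ, -κ)`, and `g⁻¹ • r = (t - 2l, κ)`. The half-turn about the midpoint of two feet exchanges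
points at equal depth on opposite sides, so `u` and `v` are at `t - τ` and `t - l - τ`
(`axis_mem_seg_opposite`). Hence `a = l`, while `b` and `c` are hypotenuses of right triangles with
legs `κ` and `|τ|`, respectively `κ` and `|l - τ|`; finally `cosh κ = coth l`.

The basepoints exist only if the seams reach depth `κ`, which is the collar lemma
`IsSeam.exists_fermi_end`. Along the line `n • axis`, `sinh` of the signed distance to the axis is
`p e^s + q e^(-s)`, where `p = n₀₀n₁₀`, `q = n₀₁n₁₁`. For a line off the axis with a common
perpendicular of length `|σ|`, minimality gives `sinh² σ = 4pq`. The line and its translate by `g`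
are disjoint or equal; a sign argument for the conjugate `n⁻¹ D n` of the translation then gives
`sinh |σ| sinh l ≥ 1`.

For foliations, transverse measures of straight paths are `|f (Q - P)|`; the slope convention fixes
the sign of `τ` relative to the coefficients of `f`. -/

/-- The point at signed distance `σ` (positive to the right) from the imaginary axis whose nearest
point on the axis is `axisPoint t`. -/
def fermi (t σ : ℝ) : ℍ :=
  UpperHalfPlane.mk ⟨Real.exp t * Real.tanh σ, Real.exp t / Real.cosh σ⟩
    (div_pos (Real.exp_pos t) (Real.cosh_pos σ))

lemma fermi_re (t σ : ℝ) : (fermi t σ).re = Real.exp t * Real.tanh σ := rfl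

lemma fermi_im (t σ : ℝ) : (fermi t σ).im = Real.exp t / Real.cosh σ := rfl

lemma fermi_zero (t : ℝ) : fermi t 0 = axisPoint t := by
  apply UpperHalfPlane.ext
  apply Complex.ext
  · change Real.exp t * Real.tanh 0 = 0
    simp
  · change Real.exp t / Real.cosh 0 = Real.exp t
    simp

lemma sinh_of_fermi {z : ℍ} {t σ : ℝ} (h : z = fermi t σ) : Real.sinh σ = z.re / z.im := by
  have := Real.exp_pos t
  have := Real.cosh_pos σ
  rw [h, fermi_re, fermi_im, Real.tanh_eq_sinh_div_cosh]
  field_simp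

lemma exists_fermi (z : ℍ) : ∃ t σ, z = fermi t σ := by
  have hy := z.im_pos
  set σ := Real.arsinh (z.re / z.im) with hσ
  have hs : Real.sinh σ = z.re / z.im := Real.sinh_arsinh _
  have hc := Real.cosh_pos σ
  refine ⟨Real.log (z.im * Real.cosh σ), σ, UpperHalfPlane.ext (Complex.ext ?_ ?_)⟩
  · change z.re = Real.exp _ * Real.tanh σ
    rw [Real.exp_log (by positivity), Real.tanh_eq_sinh_div_cosh, hs]
    field_simp
  · change z.im = Real.exp _ / Real.cosh σ
    rw [Real.exp_log (by positivity)]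
    field_simp

/-- All later distance computations reduce to this formula; for `σ = 0` it is the hyperbolic
Pythagorean theorem. -/
lemma cosh_dist_fermi (t σ t' σ' : ℝ) :
    Real.cosh (dist (fermi t σ) (fermi t' σ')) =
      Real.cosh σ * Real.cosh σ' * Real.cosh (t - t') - Real.sinh σ * Real.sinh σ' := by
  have h1 := Real.cosh_pos σ
  have h2 := Real.cosh_pos σ'
  have e1 := Real.exp_pos t
  have e2 := Real.exp_pos t'
  have i1 := Real.cosh_sq σ
  have i2 := Real.cosh_sq σ'
  rw [UpperHalfPlane.cosh_dist', fermi_re, fermi_re, fermi_im, fermi_im, Real.tanh_eq_sinh_div_cosh,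
    Real.tanh_eq_sinh_div_cosh, Real.cosh_eq (t - t'), neg_sub, Real.exp_sub, Real.exp_sub]
  field_simp
  linear_combination (-Real.exp t ^ 2 * Real.cosh σ' ^ 2) * i1 -
    Real.exp t' ^ 2 * Real.cosh σ ^ 2 * i2

lemma le_of_cosh_le {x y : ℝ} (hy : 0 ≤ y) (h : Real.cosh x ≤ Real.cosh y) : |x| ≤ y := by
  rwa [Real.cosh_le_cosh, abs_of_nonneg hy] at h

lemma cosh_injective_of_nonneg {x y : ℝ} (hx : 0 ≤ x) (hy : 0 ≤ y)
    (h : Real.cosh x = Real.cosh y) : x = y :=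
  Real.cosh_injOn hx hy h

lemma cosh_eq_one_iff {x : ℝ} : Real.cosh x = 1 ↔ x = 0 := by
  refine ⟨fun h => ?_, fun h => by simp [h]⟩
  by_contra hx
  exact (Real.one_lt_cosh.2 hx).ne' h

lemma dist_fermi_same (t σ σ' : ℝ) : dist (fermi t σ) (fermi t σ') = |σ - σ'| := by
  apply cosh_injective_of_nonneg dist_nonneg (abs_nonneg _)
  rw [cosh_dist_fermi, Real.cosh_abs, sub_self, Real.cosh_zero, mul_one, Real.cosh_sub]

lemma abs_sub_le_dist_fermi (t σ t' σ' : ℝ) : |σ - σ'| ≤ dist (fermi t σ) (fermi t' σ') := by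
  apply le_of_cosh_le dist_nonneg
  rw [cosh_dist_fermi, Real.cosh_sub]
  nlinarith [Real.one_le_cosh (t - t'), mul_pos (Real.cosh_pos σ) (Real.cosh_pos σ')]

lemma dist_fermi_axis {t t' : ℝ} : dist (fermi t 0) (fermi t' 0) = |t - t'| := by
  apply cosh_injective_of_nonneg dist_nonneg (abs_nonneg _)
  rw [cosh_dist_fermi, Real.cosh_abs]
  simp

lemma eq_of_dist_fermi_le {t σ t' : ℝ} (h : dist (fermi t 0) (fermi t' σ) ≤ |σ|) : t = t' := by
  have h' : Real.cosh (dist (fermi t 0) (fermi t' σ)) ≤ Real.cosh σ := by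
    rw [← Real.cosh_abs σ]
    rw [Real.cosh_le_cosh, abs_of_nonneg dist_nonneg]
    simpa using h
  rw [cosh_dist_fermi] at h'
  simp only [Real.cosh_zero, one_mul, Real.sinh_zero, zero_mul, sub_zero] at h'
  have hc := Real.cosh_pos σ
  have := Real.one_le_cosh (t - t')
  have : Real.cosh (t - t') = 1 := le_antisymm (by nlinarith) this
  linarith [cosh_eq_one_iff.1 this]

lemma fermi_injective {t σ t' σ' : ℝ} (h : fermi t σ = fermi t' σ') : t = t' ∧ σ = σ' := by
  have h1 := abs_sub_le_dist_fermi t σ t' σ'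
  rw [h, dist_self] at h1
  have h2 : σ = σ' := by linarith [abs_eq_zero.1 (le_antisymm h1 (abs_nonneg _))]
  subst h2
  refine ⟨?_, rfl⟩
  have h3 := congrArg UpperHalfPlane.im h
  rw [fermi_im, fermi_im] at h3
  have := Real.cosh_pos σ
  field_simp at h3
  exact Real.exp_injective h3

/-! ### Segments in Fermi coordinates -/

/-- The coordinate `σ` is 1-Lipschitz, so equality in the triangle inequality leaves `w` at distance
at most `|ρ|` from the foot, which forces it onto the same perpendicular. The condition on `ρ`
expresses betweenness for either sign of `σ`. -/
lemma mem_seg_fermi {t σ : ℝ} {w : ℍ} :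
    w ∈ seg (fermi t 0) (fermi t σ) ↔ ∃ ρ, |ρ| + |ρ - σ| = |σ| ∧ w = fermi t ρ := by
  constructor
  · intro h
    obtain ⟨t', ρ, rfl⟩ := exists_fermi w
    change _ + _ = _ at h
    rw [dist_fermi_same] at h
    have h1 := abs_sub_le_dist_fermi t 0 t' ρ
    have h2 := abs_sub_le_dist_fermi t' ρ t σ
    simp only [zero_sub, abs_neg] at h h1
    have h3 : |σ| ≤ |ρ| + |ρ - σ| := by
      simpa using abs_sub ρ (ρ - σ)
    have h4 : t = t' := eq_of_dist_fermi_le (by linarith)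
    subst h4
    exact ⟨ρ, by linarith, rfl⟩
  · rintro ⟨ρ, h, rfl⟩
    change _ + _ = _
    simpa [dist_fermi_same] using h

lemma infDist_fermi (t σ : ℝ) :
    Metric.infDist (fermi t σ) (Set.range axisPoint) = |σ| := by
  apply le_antisymm
  · refine (Metric.infDist_le_dist_of_mem (Set.mem_range_self t)).trans ?_
    rw [← fermi_zero, dist_fermi_same, sub_zero]
  · rw [Metric.le_infDist (Set.range_nonempty _)]
    rintro _ ⟨x, rfl⟩
    rw [← fermi_zero]
    simpa using abs_sub_le_dist_fermi t σ x 0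

lemma dist_fermi_opposite (κ t t' : ℝ) :
    dist (fermi t κ) (fermi t' (-κ)) = 2 * dist (fermi t κ) (fermi ((t + t') / 2) 0) := by
  apply cosh_injective_of_nonneg dist_nonneg (by positivity)
  rw [cosh_dist_fermi, Real.cosh_two_mul, Real.sinh_sq, cosh_dist_fermi]
  have h1 : t - (t + t') / 2 = (t - t') / 2 := by ring
  have h2 := Real.cosh_two_mul ((t - t') / 2)
  rw [mul_div_cancel₀ _ two_ne_zero, Real.sinh_sq] at h2
  rw [h1, h2, Real.cosh_neg, Real.sinh_neg, Real.cosh_zero, Real.sinh_zero]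
  linear_combination -Real.cosh_sq κ

lemma dist_fermi_neg (κ t x : ℝ) :
    dist (fermi x 0) (fermi t (-κ)) = dist (fermi x 0) (fermi t κ) := by
  apply cosh_injective_of_nonneg dist_nonneg dist_nonneg
  simp [cosh_dist_fermi]

/-- The midpoint lies on the segment by symmetry under a half-turn. Conversely, expand `cosh (d₁ +
d₂)`, isolate `sinh d₁ * sinh d₂` and square. For `κ = 0` the segment would lie in the axis. -/
lemma axis_mem_seg_opposite {κ t t' x : ℝ} (hκ : κ ≠ 0) :
    fermi x 0 ∈ seg (fermi t κ) (fermi t' (-κ)) ↔ x = (t + t') / 2 := by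
  constructor
  · intro h
    change _ + _ = _ at h
    set d₁ := dist (fermi t κ) (fermi x 0) with hd₁
    set d₂ := dist (fermi x 0) (fermi t' (-κ)) with hd₂
    have e₁ : Real.cosh d₁ = Real.cosh κ * Real.cosh (t - x) := by
      rw [hd₁, cosh_dist_fermi]; simp
    have e₂ : Real.cosh d₂ = Real.cosh κ * Real.cosh (x - t') := by
      rw [hd₂, cosh_dist_fermi]; simp
    have e := congrArg Real.cosh h
    rw [Real.cosh_add, cosh_dist_fermi t κ t' (-κ), Real.cosh_neg, Real.sinh_neg] at e
    have hs : 0 < Real.sinh κ ^ 2 := by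
      have : Real.sinh κ ≠ 0 := by simpa using hκ
      positivity
    have s₁ := Real.sinh_sq d₁
    have s₂ := Real.sinh_sq d₂
    have hK := Real.cosh_sq κ
    have hD : t - t' = (t - x) + (x - t') := by ring
    have hE := Real.cosh_sub (t - x) (x - t')
    have hD' := Real.cosh_add (t - x) (x - t')
    rw [← hD] at hD'
    have hp := Real.cosh_sq (t - x)
    have hq := Real.cosh_sq (x - t')
    set P := Real.cosh (t - x)
    set Q := Real.cosh (x - t')
    set p := Real.sinh (t - x)
    set q := Real.sinh (x - t')
    set D := Real.cosh (t - t')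
    set E := Real.cosh (t - x - (x - t')) with hEdef
    set C := Real.cosh κ
    set S := Real.sinh κ
    have hD1 : 1 ≤ D := Real.one_le_cosh _
    have hss : (Real.sinh d₁ * Real.sinh d₂) ^ 2 = (C ^ 2 * P ^ 2 - 1) * (C ^ 2 * Q ^ 2 - 1) := by
      rw [mul_pow, s₁, s₂, e₁, e₂]; ring
    have hss' : Real.sinh d₁ * Real.sinh d₂ = C ^ 2 * D + S ^ 2 - C ^ 2 * (P * Q) := by
      rw [e₁, e₂] at e
      linear_combination e
    rw [hss'] at hss
    have hPQ : 2 * (P * Q) = E + D := by linear_combination -hE - hD'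
    have hPQ2 : P ^ 2 + Q ^ 2 = 1 + E * D := by
      rw [hE, hD']
      linear_combination (1 - Q ^ 2) * hp - p ^ 2 * hq
    -- `E` is the `cosh` of `t + t' - 2x`, and the second factor is positive, so this makes `x` the
    -- midpoint.
    have key : (E - 1) * (C ^ 2 * S ^ 2 * (D + 1)) = 0 := by
      have hS : S ^ 2 = C ^ 2 - 1 := by linarith
      rw [hS] at hss ⊢
      linear_combination -hss + C ^ 2 * hPQ2 - C ^ 2 * (C ^ 2 * D + C ^ 2 - 1) * hPQ
    have hC : 0 < C := Real.cosh_pos _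
    have hE1 : E = 1 := by
      rcases mul_eq_zero.1 key with h | h
      · linarith
      · have : 0 < C ^ 2 * S ^ 2 * (D + 1) := by positivity
        exact absurd h this.ne'
    have := cosh_eq_one_iff.1 hE1
    linarith
  · rintro rfl
    change _ + _ = _
    rw [dist_fermi_opposite, dist_fermi_neg, two_mul]
    congr 1
    rw [dist_comm (fermi t κ)]
    apply cosh_injective_of_nonneg dist_nonneg dist_nonneg
    rw [cosh_dist_fermi, cosh_dist_fermi]
    have : (t + t') / 2 - t' = -((t + t') / 2 - t) := by ring
    rw [this, Real.cosh_neg]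

/-! ### The action of `SL(2, ℝ)` on the axis -/

lemma det_entries (m : SL(2, ℝ)) : m 0 0 * m 1 1 - m 0 1 * m 1 0 = 1 := by
  have := m.det_coe
  rwa [Matrix.det_fin_two] at this

lemma smul_axisPoint_coords (m : SL(2, ℝ)) (s : ℝ) :
    m 0 1 = (m • axisPoint s).re * m 1 1 - (m • axisPoint s).im * (m 1 0 * Real.exp s) ∧
    m 0 0 * Real.exp s =
      (m • axisPoint s).re * (m 1 0 * Real.exp s) + (m • axisPoint s).im * m 1 1 := by
  have h := UpperHalfPlane.coe_specialLinearGroup_apply m (axisPoint s)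
  have hz : ((axisPoint s : ℍ) : ℂ) = ⟨0, Real.exp s⟩ := rfl
  set w := m • axisPoint s
  rw [hz] at h
  have hne : ((m 1 0 : ℂ) * ⟨0, Real.exp s⟩ + (m 1 1 : ℂ)) ≠ 0 := by
    intro h0
    have hr := congrArg Complex.re h0
    have hi := congrArg Complex.im h0
    simp at hr hi
    have := det_entries m
    simp [hr, hi] at this
  simp only [Algebra.algebraMap_self, RingHom.id_apply] at h
  rw [eq_div_iff hne] at h
  have hr := congrArg Complex.re h
  have hi := congrArg Complex.im h
  simp at hr hi
  constructor <;> linarith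

/-- By `sinh_of_fermi` the left side is `sinh` of the signed distance to the axis, so this describes
how a line approaches or crosses it. -/
lemma smul_axisPoint_ratio (m : SL(2, ℝ)) (s : ℝ) :
    (m • axisPoint s).re / (m • axisPoint s).im =
      m 0 0 * m 1 0 * Real.exp s + m 0 1 * m 1 1 * Real.exp (-s) := by
  obtain ⟨h1, h2⟩ := smul_axisPoint_coords m s
  have hd := det_entries m
  have hy := (m • axisPoint s).im_pos
  set x := (m • axisPoint s).re
  set y := (m • axisPoint s).im
  have hE := Real.exp_pos s
  rw [Real.exp_neg]
  set E := Real.exp s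
  have e1 : E = y * (m 1 1 ^ 2 + m 1 0 ^ 2 * E ^ 2) := by
    linear_combination (-E) * hd + m 1 1 * h2 - m 1 0 * E * h1
  have e2 : m 0 1 * m 1 1 + m 0 0 * m 1 0 * E ^ 2 = x * (m 1 1 ^ 2 + m 1 0 ^ 2 * E ^ 2) := by
    linear_combination m 1 1 * h1 + m 1 0 * E * h2
  field_simp
  have hpos : m 1 1 ^ 2 + m 1 0 ^ 2 * E ^ 2 ≠ 0 := by
    intro h0; rw [h0] at e1; linarith
  apply mul_right_cancel₀ hpos
  linear_combination (-E) * e2 + (m 0 1 * m 1 1 + m 0 0 * m 1 0 * E ^ 2) * e1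

lemma translation_entries {m : SL(2, ℝ)} {a : ℝ} (h : ∀ t, m • axisPoint t = axisPoint (t + a)) :
    m 0 1 = 0 ∧ m 1 0 = 0 ∧ m 0 0 = m 1 1 * Real.exp a := by
  have key : ∀ t, m 0 1 = -(Real.exp (t + a) * (m 1 0 * Real.exp t)) ∧
      m 0 0 * Real.exp t = Real.exp (t + a) * m 1 1 := by
    intro t
    obtain ⟨h1, h2⟩ := smul_axisPoint_coords m t
    rw [h t] at h1 h2
    have hr : (axisPoint (t + a)).re = 0 := rfl
    have hi : (axisPoint (t + a)).im = Real.exp (t + a) := rfl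
    rw [hr, hi] at h1 h2
    constructor <;> linarith
  -- The factor `e^(2t + a)` takes different values at `t = 0` and `t = 1`, which forces `m 1 0 =
  -- 0`.
  obtain ⟨k1, k2⟩ := key 0
  obtain ⟨k3, -⟩ := key 1
  have hea := Real.exp_pos a
  have he1 : 1 < Real.exp 1 := Real.one_lt_exp_iff.2 one_pos
  simp only [Real.exp_add, Real.exp_zero, one_mul, mul_one] at k1 k2 k3
  have h10 : m 1 0 = 0 := by
    have : m 1 0 * (Real.exp a * (Real.exp 1 ^ 2 - 1)) = 0 := by linear_combination k3 - k1
    rcases mul_eq_zero.1 this with h | h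
    · exact h
    · have : 0 < Real.exp a * (Real.exp 1 ^ 2 - 1) := mul_pos hea (by nlinarith)
      exact absurd h this.ne'
  refine ⟨by rw [k1, h10]; ring, h10, by linarith⟩

lemma translation_smul_fermi {m : SL(2, ℝ)} {a : ℝ} (h : ∀ t, m • axisPoint t = axisPoint (t + a))
    (t σ : ℝ) : m • fermi t σ = fermi (t + a) σ := by
  obtain ⟨h1, h2, h3⟩ := translation_entries h
  have hd := det_entries m
  have h11 : m 1 1 ≠ 0 := by
    intro h0; simp [h0, h1] at hd
  apply UpperHalfPlane.ext
  rw [UpperHalfPlane.coe_specialLinearGroup_apply]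
  simp only [Algebra.algebraMap_self, RingHom.id_apply]
  rw [h1, h2, h3]
  have h11' : ((m 1 1 : ℝ) : ℂ) ≠ 0 := by exact_mod_cast h11
  have : ((fermi (t + a) σ : ℍ) : ℂ) = (Real.exp a : ℂ) * (fermi t σ : ℍ) := by
    apply Complex.ext
    · rw [Complex.re_ofReal_mul]
      change Real.exp (t + a) * Real.tanh σ = Real.exp a * (Real.exp t * Real.tanh σ)
      rw [Real.exp_add]; ring
    · rw [Complex.im_ofReal_mul]
      change Real.exp (t + a) / Real.cosh σ = Real.exp a * (Real.exp t / Real.cosh σ)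
      rw [Real.exp_add]; ring
  rw [this, Complex.ofReal_zero, zero_mul, zero_add, add_zero, div_eq_iff h11', Complex.ofReal_mul]
  ring

lemma smul_axisPoint_mem_axis {m : SL(2, ℝ)} {s : ℝ}
    (h : m 0 0 * m 1 0 * Real.exp s + m 0 1 * m 1 1 * Real.exp (-s) = 0) :
    m • axisPoint s ∈ Set.range axisPoint := by
  obtain ⟨t, σ, hz⟩ := exists_fermi (m • axisPoint s)
  have h1 := sinh_of_fermi hz
  rw [smul_axisPoint_ratio, h] at h1
  have : σ = 0 := by simpa using h1
  exact ⟨t, by rw [hz, this, fermi_zero]⟩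

/-! ### Disjoint lines and the collar inequality -/

/-- A geodesic line that does not cross the axis has endpoints that are not separated by it. -/
lemma entries_nonneg_of_disjoint_or_eq {m : SL(2, ℝ)}
    (h : Disjoint (Set.range fun s => m • axisPoint s) (Set.range axisPoint) ∨
      (Set.range fun s => m • axisPoint s) = Set.range axisPoint) :
    0 ≤ (m 0 0 * m 1 0) * (m 0 1 * m 1 1) := by
  by_contra! hneg
  rcases h with h | h
  · have hp : m 0 0 * m 1 0 ≠ 0 := by
      intro h0; simp [h0] at hneg
    set p := m 0 0 * m 1 0 with hpdef
    set q := m 0 1 * m 1 1 with hqdef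
    have hr : 0 < -q / p := by
      have : -q / p = -(p * q) / p ^ 2 := by field_simp
      rw [this]
      exact div_pos (by linarith) (by positivity)
    -- The parameter solves `e^(2s) = -q / p`; there the line would meet the axis.
    have hz : p * Real.exp (Real.log (-q / p) / 2) + q * Real.exp (-(Real.log (-q / p) / 2)) = 0 := by
      have he := Real.exp_pos (Real.log (-q / p) / 2)
      have h2 : Real.exp (Real.log (-q / p) / 2) ^ 2 = -q / p := by
        rw [← Real.exp_nat_mul]
        push_cast
        rw [mul_div_cancel₀ _ two_ne_zero, Real.exp_log hr]
      rw [Real.exp_neg]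
      rw [eq_div_iff hp] at h2
      generalize Real.exp (Real.log (-q / p) / 2) = E at he h2 ⊢
      field_simp
      linarith
    exact Set.disjoint_left.1 h ⟨_, rfl⟩ (smul_axisPoint_mem_axis hz)
  · have hz : ∀ s, m 0 0 * m 1 0 * Real.exp s + m 0 1 * m 1 1 * Real.exp (-s) = 0 := by
      intro s
      have hs : m • axisPoint s ∈ Set.range axisPoint := h ▸ ⟨s, rfl⟩
      obtain ⟨t, ht⟩ := hs
      rw [← smul_axisPoint_ratio, ← ht]
      have : (axisPoint t).re = 0 := rfl
      rw [this, zero_div]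
    have h0 := hz 0
    simp only [Real.exp_zero, neg_zero, mul_one] at h0
    have : m 0 1 * m 1 1 = -(m 0 0 * m 1 0) := by linarith
    rw [this] at hneg
    have h1 := hz 1
    rw [this, Real.exp_neg] at h1
    have he1 : 1 < Real.exp 1 := Real.one_lt_exp_iff.2 one_pos
    have h2 : m 0 0 * m 1 0 * (Real.exp 1 ^ 2 - 1) = 0 := by
      field_simp at h1
      linarith
    rcases mul_eq_zero.1 h2 with h3 | h3
    · simp [h3] at hneg
    · nlinarith

/-- If a line has the common perpendicular with the axis from `axisPoint t` to its point of
parameter `s`, then the length of the perpendicular is determined by the entries of the matrix. -/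
lemma exists_fermi_of_perpendicular {n : SL(2, ℝ)} {t s : ℝ}
    (hmin : ∀ x y, dist (axisPoint t) (n • axisPoint s) ≤ dist (axisPoint x) (n • axisPoint y)) :
    ∃ σ, n • axisPoint s = fermi t σ ∧
      (σ ≠ 0 → Real.sinh σ ^ 2 = 4 * ((n 0 0 * n 1 0) * (n 0 1 * n 1 1))) := by
  obtain ⟨t', σ, hz⟩ := exists_fermi (n • axisPoint s)
  have ht : t = t' := by
    apply eq_of_dist_fermi_le (σ := σ)
    have := hmin t' s
    rw [hz, ← fermi_zero, ← fermi_zero, dist_fermi_same] at this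
    simpa using this
  subst ht
  refine ⟨σ, hz, fun hσ => ?_⟩
  set p := n 0 0 * n 1 0 with hp
  set q := n 0 1 * n 1 1 with hq
  have hF : Real.sinh σ = p * Real.exp s + q * Real.exp (-s) := by
    rw [sinh_of_fermi hz, smul_axisPoint_ratio]
  -- `s` minimizes the distance to the axis along the line, hence also its `sinh²`.
  have hle : ∀ y, (p * Real.exp s + q * Real.exp (-s)) ^ 2 ≤
      (p * Real.exp y + q * Real.exp (-y)) ^ 2 := by
    intro y
    obtain ⟨x, ρ, hy⟩ := exists_fermi (n • axisPoint y)
    have hG : Real.sinh ρ = p * Real.exp y + q * Real.exp (-y) := by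
      rw [sinh_of_fermi hy, smul_axisPoint_ratio]
    have h1 := hmin x y
    rw [hz, hy, ← fermi_zero, ← fermi_zero, dist_fermi_same, dist_fermi_same] at h1
    simp only [zero_sub, abs_neg] at h1
    rw [← hF, ← hG, Real.sinh_sq, Real.sinh_sq]
    have h2 := Real.cosh_le_cosh.2 h1
    have := Real.cosh_pos σ
    nlinarith
  have hloc : IsLocalMin (fun y => (p * Real.exp y + q * Real.exp (-y)) ^ 2) s :=
    Filter.Eventually.of_forall hle
  have hder : HasDerivAt (fun y => (p * Real.exp y + q * Real.exp (-y)) ^ 2)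
      (2 * (p * Real.exp s + q * Real.exp (-s)) * (p * Real.exp s - q * Real.exp (-s))) s := by
    have h1 := (Real.hasDerivAt_exp s).const_mul p
    have h2 := ((hasDerivAt_neg s).exp).const_mul q
    refine ((h1.add h2).pow 2).congr_deriv ?_
    simp only [Pi.add_apply]
    push_cast
    ring
  have h0 := hloc.hasDerivAt_eq_zero hder
  rw [← hF] at h0
  have hs : Real.sinh σ ≠ 0 := by simpa using hσ
  -- At the critical point the two terms agree, since their sum is not zero; their product is `p *
  -- q`.
  have h1 : p * Real.exp s = q * Real.exp (-s) := by
    rcases mul_eq_zero.1 h0 with h | h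
    · exact absurd (by linarith) hs
    · linarith
  rw [hF]
  have he : Real.exp s * Real.exp (-s) = 1 := by rw [← Real.exp_add]; simp
  linear_combination (p * Real.exp s - q * Real.exp (-s)) * h1 + 4 * p * q * he

/-- The collar inequality for a line and its translate along the axis. -/
lemma one_le_of_translate_disjoint_or_eq {n D : SL(2, ℝ)} {l : ℝ}
    (hD : ∀ t, D • axisPoint t = axisPoint (t + 2 * l))
    (hl : 0 < l) (hpos : 0 < (n 0 0 * n 1 0) * (n 0 1 * n 1 1))
    (h : Disjoint (Set.range fun s => (n⁻¹ * D * n) • axisPoint s) (Set.range axisPoint) ∨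
      (Set.range fun s => (n⁻¹ * D * n) • axisPoint s) = Set.range axisPoint) :
    1 ≤ 4 * ((n 0 0 * n 1 0) * (n 0 1 * n 1 1)) * Real.sinh l ^ 2 := by
  have h1 := entries_nonneg_of_disjoint_or_eq h
  have hdm := det_entries (n⁻¹ * D * n)
  obtain ⟨b, c, hadl⟩ := translation_entries hD
  have hdD := det_entries D
  have hdn := det_entries n
  have hoff : (n⁻¹ * D * n) 0 1 * (n⁻¹ * D * n) 1 0 =
      -((n 0 0 * n 1 0) * (n 0 1 * n 1 1)) * (D 0 0 - D 1 1) ^ 2 := by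
    have i00 : n⁻¹ 0 0 = n 1 1 := by
      simp [Matrix.SpecialLinearGroup.coe_inv, Matrix.adjugate_fin_two]
    have i01 : n⁻¹ 0 1 = -n 0 1 := by
      simp [Matrix.SpecialLinearGroup.coe_inv, Matrix.adjugate_fin_two]
    have i10 : n⁻¹ 1 0 = -n 1 0 := by
      simp [Matrix.SpecialLinearGroup.coe_inv, Matrix.adjugate_fin_two]
    have i11 : n⁻¹ 1 1 = n 0 0 := by
      simp [Matrix.SpecialLinearGroup.coe_inv, Matrix.adjugate_fin_two]
    simp only [Matrix.SpecialLinearGroup.coe_mul, Matrix.mul_apply, Fin.sum_univ_two, b, c,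
      i00, i01, i10, i11]
    ring
  -- `D` is `± diag (e^l, e^(-l))`.
  have hsq : (D 0 0 - D 1 1) ^ 2 = 4 * Real.sinh l ^ 2 := by
    rw [b, hadl] at hdD
    rw [hadl, Real.sinh_eq, Real.exp_neg]
    have he : Real.exp (2 * l) = Real.exp l ^ 2 := by
      rw [← Real.exp_nat_mul]; push_cast; rfl
    rw [he] at hdD ⊢
    have := Real.exp_pos l
    field_simp
    linear_combination 4 * (Real.exp l ^ 2 - 1) ^ 2 * hdD
  have hs : 0 < Real.sinh l := Real.sinh_pos_iff.2 hl
  have hneg : (n⁻¹ * D * n) 0 1 * (n⁻¹ * D * n) 1 0 < 0 := by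
    rw [hoff, hsq]
    have : 0 < (n 0 0 * n 1 0) * (n 0 1 * n 1 1) * (4 * Real.sinh l ^ 2) := by positivity
    linarith
  -- By `h1` the diagonal and off-diagonal products cannot have opposite signs; the determinant then
  -- bounds minus the off-diagonal product below by 1.
  have h2 : (n⁻¹ * D * n) 0 0 * (n⁻¹ * D * n) 1 1 ≤ 0 := by
    by_contra! h3
    have := mul_neg_of_pos_of_neg h3 hneg
    linarith
  rw [hoff, hsq] at hdm
  linarith

/-! ### Linear foliations -/

lemma transverseMeasure_straight (f : ℝ × ℝ →ₗ[ℝ] ℝ) (P Q : ℝ × ℝ) :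
    transverseMeasure f (straight P Q) = |f (Q - P)| := by
  have h : ∀ s, f (straight P Q s) = f P + s * f (Q - P) := by
    intro s
    simp [straight, AffineMap.lineMap_apply]
    ring
  have hd : ∀ t, deriv (fun s => f (straight P Q s)) t = f (Q - P) := by
    intro t
    simp_rw [h]
    simp
  simp [transverseMeasure, hd]

lemma linear_apply_eq (f : ℝ × ℝ →ₗ[ℝ] ℝ) (x y : ℝ) : f (x, y) = x * f (1, 0) + y * f (0, 1) := by
  have : ((x, y) : ℝ × ℝ) = x • (1, 0) + y • (0, 1) := by simp
  rw [this, map_add, map_smul, map_smul, smul_eq_mul, smul_eq_mul]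

theorem foliationTriangle_eq {f : ℝ × ℝ →ₗ[ℝ] ℝ} {l τ : ℝ} (h : IsDehnThurston f (2 * l) (2 * τ)) :
    foliationTriangle f = (l, |τ|, |l - τ|) := by
  obtain ⟨h1, h2, h3⟩ := h
  simp only [foliationTriangle]
  rw [transverseMeasure_straight] at h1 h2
  rw [transverseMeasure_straight, transverseMeasure_straight, transverseMeasure_straight]
  simp only [Prod.mk_sub_mk, sub_zero, sub_self, sub_neg_eq_add] at h1 h2 ⊢
  rw [linear_apply_eq f (1 + 1)] at h1
  rw [linear_apply_eq f 0 (1 + 1)] at h2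
  rw [linear_apply_eq f 1 1]
  set α := f (1, 0) with hα
  set β := f (0, 1) with hβ
  have hl : l = |α| := by
    rw [show (1 + 1) * α + 0 * β = 2 * α by ring, abs_mul, abs_two] at h1
    linarith
  have ht : |τ| = |β| := by
    rw [show 0 * α + (1 + 1) * β = 2 * β by ring, abs_mul, abs_mul, abs_two] at h2
    linarith
  have hsign : 0 < l → τ * (β * α) ≤ 0 := by
    intro hl0
    -- The vector `(-β, α)` spans the leaf direction.
    have := h3 (by linarith) (-β, α) (by rw [linear_apply_eq, ← hα, ← hβ]; ring)
    simp only at this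
    nlinarith
  refine Prod.ext hl.symm (Prod.ext ht.symm ?_)
  simp only [one_mul]
  rcases lt_trichotomy α 0 with ha | ha | ha
  · rw [abs_of_neg ha] at hl
    have h5 := hsign (by linarith)
    have : τ = β := by
      rcases abs_eq_abs.1 ht with h | h
      · exact h
      · rw [h] at h5 ⊢
        have : β * β ≤ 0 := by nlinarith
        have : β = 0 := by nlinarith
        simp [this]
    rw [hl, this, ← abs_neg]
    congr 1; ring
  · rw [ha, abs_zero] at hl
    rw [hl, ha]
    simp [ht]
  · rw [abs_of_pos ha] at hl
    have h5 := hsign (by linarith)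
    have : τ = -β := by
      rcases abs_eq_abs.1 ht with h | h
      · rw [h] at h5 ⊢
        have : β * β ≤ 0 := by nlinarith
        have : β = 0 := by nlinarith
        simp [this]
      · exact h
    rw [hl, this]
    congr 1; ring

/-! ### Configurations in a moving frame -/

lemma line_eq_smul (k : SL(2, ℝ)) : line k = k • Set.range axisPoint := by
  ext z
  simp [line, geodesic, Set.mem_smul_set]

lemma geodesic_eq (k : SL(2, ℝ)) (t : ℝ) : geodesic k t = k • fermi t 0 := by
  rw [fermi_zero, geodesic]

lemma geodesic_injective (k : SL(2, ℝ)) : Function.Injective (geodesic k) := by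
  intro t t' h
  rw [geodesic_eq, geodesic_eq] at h
  exact (fermi_injective (MulAction.injective k h)).1

lemma smul_mem_seg (k : SL(2, ℝ)) (p q w : ℍ) : k • w ∈ seg (k • p) (k • q) ↔ w ∈ seg p q := by
  simp [seg, dist_smul]

lemma exists_smul_fermi (k : SL(2, ℝ)) (z : ℍ) : ∃ t σ, z = k • fermi t σ := by
  obtain ⟨t, σ, h⟩ := exists_fermi (k⁻¹ • z)
  exact ⟨t, σ, by rw [← h, smul_inv_smul]⟩

lemma infDist_smul_fermi (k : SL(2, ℝ)) (t σ : ℝ) :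
    Metric.infDist (k • fermi t σ) (line k) = |σ| := by
  rw [← infDist_fermi t σ, line_eq_smul]
  exact Metric.infDist_image (isometry_smul ℍ k)

lemma mem_seg_smul_fermi {k : SL(2, ℝ)} {t σ : ℝ} {w : ℍ} :
    w ∈ seg (geodesic k t) (k • fermi t σ) ↔ ∃ ρ, |ρ| + |ρ - σ| = |σ| ∧ w = k • fermi t ρ := by
  obtain ⟨x, ρ, rfl⟩ := exists_smul_fermi k w
  rw [geodesic_eq, smul_mem_seg, mem_seg_fermi]
  simp only [smul_left_cancel_iff]

lemma geodesic_mem_seg_opposite {k : SL(2, ℝ)} {κ t t' x : ℝ} (hκ : κ ≠ 0) :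
    geodesic k x ∈ seg (k • fermi t κ) (k • fermi t' (-κ)) ↔ x = (t + t') / 2 := by
  rw [geodesic_eq, smul_mem_seg, axis_mem_seg_opposite hκ]

/-- The points at distance `κ` from the axis on a perpendicular to it. -/
lemma mem_seg_and_infDist_iff {k : SL(2, ℝ)} {t σ κ : ℝ} {w : ℍ} (hκ : 0 ≤ κ) (h : κ ≤ σ) :
    (w ∈ seg (geodesic k t) (k • fermi t σ) ∧ Metric.infDist w (line k) = κ) ↔
      w = k • fermi t κ := by
  rw [mem_seg_smul_fermi]
  constructor
  · rintro ⟨⟨ρ, h1, rfl⟩, h2⟩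
    rw [infDist_smul_fermi] at h2
    rw [h2, abs_of_nonneg (hκ.trans h)] at h1
    rcases abs_choice ρ with h3 | h3
    · rw [← h2, h3]
    · have h4 : κ + (σ - ρ) ≤ σ := by
        rw [← h1]; linarith [neg_abs_le (ρ - σ)]
      have : ρ = κ := by linarith
      rw [this]
  · rintro rfl
    refine ⟨⟨κ, ?_, rfl⟩, ?_⟩
    · rw [abs_of_nonneg hκ, abs_of_nonneg (hκ.trans h), abs_of_nonpos (by linarith)]; ring
    · rw [infDist_smul_fermi, abs_of_nonneg hκ]

lemma mem_seg_and_infDist_iff_neg {k : SL(2, ℝ)} {t σ κ : ℝ} {w : ℍ} (hκ : 0 ≤ κ) (h : σ ≤ -κ) :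
    (w ∈ seg (geodesic k t) (k • fermi t σ) ∧ Metric.infDist w (line k) = κ) ↔
      w = k • fermi t (-κ) := by
  rw [mem_seg_smul_fermi]
  constructor
  · rintro ⟨⟨ρ, h1, rfl⟩, h2⟩
    rw [infDist_smul_fermi] at h2
    rw [h2, abs_of_nonpos (by linarith : σ ≤ 0)] at h1
    rcases abs_choice ρ with h3 | h3
    · have h4 := le_abs_self (ρ - σ)
      have : ρ = -κ := by linarith
      rw [this]
    · rw [← h2, h3, neg_neg]
  · rintro rfl
    refine ⟨⟨-κ, ?_, rfl⟩, ?_⟩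
    · rw [abs_neg, abs_of_nonneg hκ, abs_of_nonpos (by linarith : σ ≤ 0),
        abs_of_nonneg (by linarith)]
      ring
    · rw [infDist_smul_fermi, abs_neg, abs_of_nonneg hκ]

/-! ### The core translation -/

/-- Each length is a positive integer multiple of the other. This is needed because
`IsTriangleLengths` chooses its own translation. -/
lemma IsCoreTranslation.len_eq {Γ : Subgroup SL(2, ℝ)} {k g g' : SL(2, ℝ)} {len len' : ℝ}
    (h : IsCoreTranslation Γ k g len) (h' : IsCoreTranslation Γ k g' len') : len' = len := by
  have key : ∀ {g g' : SL(2, ℝ)} {len len' : ℝ}, IsCoreTranslation Γ k g len →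
      IsCoreTranslation Γ k g' len' → len ≤ len' := by
    intro g g' len len' h h'
    have hline : g' • line k = line k := by
      ext z
      constructor
      · rintro ⟨_, ⟨t, rfl⟩, rfl⟩
        exact ⟨t + len', (h'.translates t).symm⟩
      · rintro ⟨t, rfl⟩
        refine ⟨_, ⟨t - len', rfl⟩, ?_⟩
        change g' • geodesic k (t - len') = _
        rw [h'.translates, sub_add_cancel]
    obtain ⟨n, hn⟩ := h.generates g' h'.mem hline
    have h0 := hn 0
    rw [h'.translates] at h0
    have h1 : len' = n * len := by simpa using geodesic_injective k h0
    have hn0 : 0 < n := by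
      by_contra! hn0
      have : (n : ℝ) ≤ 0 := by exact_mod_cast hn0
      nlinarith [h.pos, h'.pos]
    have : (1 : ℝ) ≤ n := by exact_mod_cast hn0
    nlinarith [h.pos]
  exact le_antisymm (key h' h) (key h h')

lemma IsCoreTranslation.conj_smul_axisPoint {Γ : Subgroup SL(2, ℝ)} {k g : SL(2, ℝ)} {len : ℝ}
    (h : IsCoreTranslation Γ k g len) (t : ℝ) :
    (k⁻¹ * g * k) • axisPoint t = axisPoint (t + len) := by
  have := h.translates t
  rw [geodesic, geodesic] at this
  rw [mul_smul, mul_smul, this, inv_smul_smul]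

lemma IsCoreTranslation.smul_fermi {Γ : Subgroup SL(2, ℝ)} {k g : SL(2, ℝ)} {len : ℝ}
    (h : IsCoreTranslation Γ k g len) (t σ : ℝ) :
    g • k • fermi t σ = k • fermi (t + len) σ := by
  rw [← translation_smul_fermi h.conj_smul_axisPoint, mul_smul, mul_smul, smul_inv_smul]

lemma IsCoreTranslation.inv_smul_fermi {Γ : Subgroup SL(2, ℝ)} {k g : SL(2, ℝ)} {len : ℝ}
    (h : IsCoreTranslation Γ k g len) (t σ : ℝ) :
    g⁻¹ • k • fermi t σ = k • fermi (t - len) σ := by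
  rw [inv_smul_eq_iff, h.smul_fermi, sub_add_cancel]

/-! ### The seams -/

lemma IsPantsDecomposition.smul_mem {Γ : Subgroup SL(2, ℝ)} {𝓛 : Set (Set ℍ)}
    (h : IsPantsDecomposition Γ 𝓛) {g : SL(2, ℝ)} (hg : g ∈ Γ) {A : Set ℍ} (hA : A ∈ 𝓛) :
    g • A ∈ 𝓛 := by
  obtain ⟨F, -, hF⟩ := h.lifts
  rw [hF] at hA ⊢
  obtain ⟨B, hB, γ, hγ, rfl⟩ := hA
  exact ⟨B, hB, g * γ, Γ.mul_mem hg hγ, (mul_smul g γ B).symm⟩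

lemma collarDepth_pos {l : ℝ} (hl : 0 < l) : 0 < collarDepth l := by
  have := Real.sinh_pos_iff.2 hl
  exact Real.arsinh_pos_iff.2 (by positivity)

lemma cosh_collarDepth {l : ℝ} (hl : 0 < l) : Real.cosh (collarDepth l) = coth l := by
  have hs := Real.sinh_pos_iff.2 hl
  have hc := Real.cosh_pos l
  rw [collarDepth, Real.cosh_arsinh, coth, Real.sqrt_eq_iff_mul_self_eq (by positivity)
    (by positivity)]
  field_simp
  linarith [Real.cosh_sq l]

/-- The collar lemma: the seams are at least as long as the collar is deep. -/
theorem IsSeam.exists_fermi_end {Γ : Subgroup SL(2, ℝ)} {𝓛 : Set (Set ℍ)}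
    (hP : IsPantsDecomposition Γ 𝓛) {k g : SL(2, ℝ)} {U L : Set ℍ} {p q : ℍ} {l t : ℝ}
    (hS : IsSeam Γ 𝓛 U (line k) L p q) (hg : IsCoreTranslation Γ k g (2 * l))
    (hp : p = geodesic k t) :
    ∃ σ, q = k • fermi t σ ∧ collarDepth l ≤ |σ| := by
  have hl : 0 < l := by linarith [hg.pos]
  have hsl := Real.sinh_pos_iff.2 hl
  obtain ⟨k', hL⟩ := hP.isLine L hS.mem_right
  have hne : line k ≠ L := by
    simpa using hS.distinct 1 Γ.one_mem (one_smul _ U)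
  have hdisj := hP.disjoint _ hS.mem_left _ hS.mem_right hne
  obtain ⟨s, hs⟩ : q ∈ line k' := hL ▸ hS.end_mem
  have hk : ∀ y, geodesic k' y = k • (k⁻¹ * k') • axisPoint y := by
    intro y
    rw [← mul_smul, mul_inv_cancel_left, geodesic]
  have hmin : ∀ x y, dist (axisPoint t) ((k⁻¹ * k') • axisPoint s) ≤
      dist (axisPoint x) ((k⁻¹ * k') • axisPoint y) := by
    intro x y
    have h1 := hS.perpendicular (geodesic k x) ⟨x, rfl⟩ (geodesic k' y) (hL ▸ ⟨y, rfl⟩)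
    rwa [hp, ← hs, hk, hk, geodesic, geodesic, dist_smul, dist_smul] at h1
  obtain ⟨σ, hσ, hsinh⟩ := exists_fermi_of_perpendicular hmin
  have hq : q = k • fermi t σ := by rw [← hs, hk, hσ]
  have hσ0 : σ ≠ 0 := by
    rintro rfl
    exact Set.disjoint_left.1 hdisj ⟨t, by rw [hq, geodesic_eq]⟩ hS.end_mem
  refine ⟨σ, hq, ?_⟩
  replace hsinh := hsinh hσ0
  have hs0 : 0 < Real.sinh σ ^ 2 := by
    have : Real.sinh σ ≠ 0 := by simpa using hσ0
    positivity
  have hcollar : 1 ≤ Real.sinh σ ^ 2 * Real.sinh l ^ 2 := by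
    rw [hsinh]
    refine one_le_of_translate_disjoint_or_eq hg.conj_smul_axisPoint hl (by linarith) ?_
    -- Seen from the frame `k'`, in which `L` is the axis, this line is the translate `g • L`.
    have hrange : (Set.range fun y => ((k⁻¹ * k')⁻¹ * (k⁻¹ * g * k) * (k⁻¹ * k')) • axisPoint y) =
        k'⁻¹ • g • L := by
      have : (k⁻¹ * k')⁻¹ * (k⁻¹ * g * k) * (k⁻¹ * k') = k'⁻¹ * g * k' := by group
      rw [this, hL, line_eq_smul, ← mul_smul, ← mul_smul, ← Set.image_smul, ← Set.range_comp]
      rfl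
    have haxis : Set.range axisPoint = k'⁻¹ • L := by
      rw [hL, line_eq_smul, inv_smul_smul]
    rw [hrange, haxis]
    by_cases h : g • L = L
    · right; rw [h]
    · left
      rw [Set.disjoint_smul_set]
      exact hP.disjoint _ (hP.smul_mem hg.mem hS.mem_right) _ hS.mem_right h
  have h1 : 1 ≤ |Real.sinh σ| * Real.sinh l := by
    rw [← abs_of_pos hsl, ← abs_mul, ← sq_le_sq₀ zero_le_one (abs_nonneg _), sq_abs]
    linarith
  rw [collarDepth, ← Real.arsinh_sinh |σ|, Real.arsinh_le_arsinh, ← Real.abs_sinh,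
    div_le_iff₀ hsl]
  exact h1

lemma continuous_inv_smul_re (k : SL(2, ℝ)) : Continuous fun z : ℍ => (k⁻¹ • z).re :=
  UpperHalfPlane.continuous_re.comp (isometry_smul ℍ k⁻¹).continuous

/-- The collar lemma bounds only `|σ|`; the side on which the pants lie fixes its sign. -/
lemma nonneg_of_mem_closure_rightSide {k : SL(2, ℝ)} {t σ : ℝ} {U : Set ℍ}
    (hU : U ⊆ rightSide k) (h : k • fermi t σ ∈ closure U) : 0 ≤ σ := by
  have hc : IsClosed {z : ℍ | 0 ≤ (k⁻¹ • z).re} :=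
    isClosed_le continuous_const (continuous_inv_smul_re k)
  have hsub : U ⊆ {z : ℍ | 0 ≤ (k⁻¹ • z).re} := by
    intro z hz
    exact (show 0 < (k⁻¹ • z).re from hU hz).le
  have h1 := closure_minimal hsub hc h
  rw [Set.mem_ofPred_eq, inv_smul_smul] at h1
  rw [← Real.sinh_nonneg_iff, sinh_of_fermi rfl]
  exact div_nonneg h1 (fermi t σ).im_pos.le

lemma nonpos_of_mem_closure_leftSide {k : SL(2, ℝ)} {t σ : ℝ} {U : Set ℍ}
    (hU : U ⊆ leftSide k) (h : k • fermi t σ ∈ closure U) : σ ≤ 0 := by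
  have hc : IsClosed {z : ℍ | (k⁻¹ • z).re ≤ 0} :=
    isClosed_le (continuous_inv_smul_re k) continuous_const
  have hsub : U ⊆ {z : ℍ | (k⁻¹ • z).re ≤ 0} := by
    intro z hz
    exact (show (k⁻¹ • z).re < 0 from hU hz).le
  have h1 := closure_minimal hsub hc h
  rw [Set.mem_ofPred_eq, inv_smul_smul] at h1
  rw [← Real.sinh_nonpos_iff, sinh_of_fermi rfl]
  exact div_nonpos_of_nonpos_of_nonneg h1 (fermi t σ).im_pos.le

/-! ### The triangle lengths -/

lemma dist_smul_fermi_eq_arcosh (k : SL(2, ℝ)) (t x κ : ℝ) :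
    dist (geodesic k x) (k • fermi t (-κ)) = Real.arcosh (Real.cosh (x - t) * Real.cosh κ) := by
  rw [geodesic_eq, dist_smul, ← Real.arcosh_cosh (x := dist _ _) dist_nonneg, cosh_dist_fermi]
  simp [mul_comm]

theorem isTriangleLengths_iff {Γ : Subgroup SL(2, ℝ)} {𝓛 : Set (Set ℍ)}
    (hP : IsPantsDecomposition Γ 𝓛) {M : MarkedCurve Γ 𝓛} {l τ : ℝ}
    (hFN : IsFenchelNielsen M (2 * l) (2 * τ)) (a b c : ℝ) :
    IsTriangleLengths M a b c ↔ a = l ∧ b = Real.arcosh (Real.cosh τ * coth l) ∧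
      c = Real.arcosh (Real.cosh (l - τ) * coth l) := by
  obtain ⟨⟨g₀, hg₀⟩, t, hr, hs⟩ := hFN
  have hl : 0 < l := by linarith [hg₀.pos]
  obtain ⟨σ, hq, hσ⟩ := M.rightSeam.exists_fermi_end hP hg₀ hr
  obtain ⟨σ', hq', hσ'⟩ := M.leftSeam.exists_fermi_end hP hg₀ hs
  have h1 := nonneg_of_mem_closure_rightSide M.rightPants_subset
    (hq ▸ M.rightSeam.boundary_right M.rightSeam.end_mem)
  have h2 := nonpos_of_mem_closure_leftSide M.leftPants_subset
    (hq' ▸ M.leftSeam.boundary_right M.leftSeam.end_mem)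
  rw [abs_of_nonneg h1] at hσ
  rw [abs_of_nonpos h2] at hσ'
  have hκ := collarDepth_pos hl
  have hr_iff := fun w => mem_seg_and_infDist_iff (k := M.frame) (t := t) (w := w) hκ.le hσ
  have hs_iff := fun w => mem_seg_and_infDist_iff_neg (k := M.frame) (t := t - 2 * τ) (w := w)
    hκ.le (by linarith : σ' ≤ -collarDepth l)
  -- The midpoints of the feet of `r`, `s` and of `g⁻¹ • r`, `s`.
  have hu_eq : (t + (t - 2 * τ)) / 2 = t - τ := by ring
  have hv_eq : (t - 2 * l + (t - 2 * τ)) / 2 = t - l - τ := by ring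
  have hdist : dist (geodesic M.frame (t - l - τ)) (geodesic M.frame (t - τ)) = l := by
    rw [geodesic_eq, geodesic_eq, dist_smul, dist_fermi_axis]
    rw [show t - l - τ - (t - τ) = -l by ring, abs_neg, abs_of_pos hl]
  have hb := dist_smul_fermi_eq_arcosh M.frame (t - 2 * τ) (t - τ) (collarDepth l)
  have hc := dist_smul_fermi_eq_arcosh M.frame (t - 2 * τ) (t - l - τ) (collarDepth l)
  rw [cosh_collarDepth hl, show t - τ - (t - 2 * τ) = τ by ring] at hb
  rw [cosh_collarDepth hl, show t - l - τ - (t - 2 * τ) = -(l - τ) by ring, Real.cosh_neg] at hc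
  constructor
  · rintro ⟨g, len, r, s, u, v, hg, hr1, hr2, hs1, hs2, ⟨x, rfl⟩, hu, ⟨y, rfl⟩, hv, rfl, rfl, rfl⟩
    obtain rfl := hg₀.len_eq hg
    rw [mul_div_cancel_left₀ _ two_ne_zero] at hr2 hs2
    rw [hr, hq] at hr1
    rw [hs, hq'] at hs1
    obtain rfl := (hr_iff r).1 ⟨hr1, hr2⟩
    obtain rfl := (hs_iff s).1 ⟨hs1, hs2⟩
    rw [hg.inv_smul_fermi, geodesic_mem_seg_opposite hκ.ne', hv_eq] at hv
    rw [geodesic_mem_seg_opposite hκ.ne', hu_eq] at hu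
    subst hu hv
    exact ⟨hdist, hb, hc⟩
  · rintro ⟨rfl, rfl, rfl⟩
    obtain ⟨r1, r2⟩ := (hr_iff _).2 rfl
    obtain ⟨s1, s2⟩ := (hs_iff _).2 rfl
    refine ⟨g₀, _, _, _, geodesic M.frame (t - τ), geodesic M.frame (t - a - τ), hg₀,
      by rw [hr, hq]; exact r1, ?_, by rw [hs, hq']; exact s1, ?_, ⟨_, rfl⟩, ?_, ⟨_, rfl⟩, ?_,
      hdist.symm, hb.symm, hc.symm⟩
    · rw [mul_div_cancel_left₀ _ two_ne_zero]; exact r2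
    · rw [mul_div_cancel_left₀ _ two_ne_zero]; exact s2
    · rw [geodesic_mem_seg_opposite hκ.ne', hu_eq]
    · rw [hg₀.inv_smul_fermi, geodesic_mem_seg_opposite hκ.ne', hv_eq]

end

end CollarParameters

/-! ### The proposition -/

theorem mainTheorem5 :
    (∀ (Γ : Subgroup SL(2, ℝ)) (𝓛 : Set (Set ℍ)),
      CollarParameters.IsClosedSurfaceGroup Γ → CollarParameters.IsPantsDecomposition Γ 𝓛 →
      ∀ (M : CollarParameters.MarkedCurve Γ 𝓛) (l τ : ℝ),
        CollarParameters.IsFenchelNielsen M (2 * l) (2 * τ) →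
        (∀ a b c : ℝ, CollarParameters.IsTriangleLengths M a b c ↔
          a = l ∧
          b = Real.arcosh (Real.cosh τ * CollarParameters.coth l) ∧
          c = Real.arcosh (Real.cosh (l - τ) * CollarParameters.coth l)) ∧
        (∀ x y : ℝ, CollarParameters.IsCollarParameters M (x, y) ↔
          x = 4 * l - 2 * Real.arcosh (Real.cosh τ * CollarParameters.coth l)
              - 2 * Real.arcosh (Real.cosh (l - τ) * CollarParameters.coth l) ∧
          y = 2 * Real.arcosh (Real.cosh τ * CollarParameters.coth l)
              - 2 * Real.arcosh (Real.cosh (l - τ) * CollarParameters.coth l))) ∧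
    (∀ (f : ℝ × ℝ →ₗ[ℝ] ℝ) (l τ : ℝ), CollarParameters.IsDehnThurston f (2 * l) (2 * τ) →
      CollarParameters.foliationTriangle f = (l, |τ|, |l - τ|) ∧
      CollarParameters.collarMap (CollarParameters.foliationTriangle f) =
        (4 * l - 2 * |τ| - 2 * |l - τ|, 2 * |τ| - 2 * |l - τ|)) := by
  refine ⟨fun Γ 𝓛 _ hP M l τ hFN => ?_, fun f l τ h => ?_⟩
  · have key := CollarParameters.isTriangleLengths_iff hP hFN
    refine ⟨key, fun x y => ?_⟩
    simp only [CollarParameters.IsCollarParameters, key, CollarParameters.collarMap]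
    constructor
    · rintro ⟨a, b, c, ⟨rfl, rfl, rfl⟩, h⟩
      simpa using h
    · rintro ⟨rfl, rfl⟩
      exact ⟨_, _, _, ⟨rfl, rfl, rfl⟩, rfl⟩
  · have key := CollarParameters.foliationTriangle_eq h
    rw [key]
    exact ⟨rfl, rfl⟩
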